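/- Let $\Lambda$ be a left and right noetherian ring, and let $$0\to\Lambda\to I_0\to I_1\to\cdots\to I_i\to\cdots$$ be a minimal injective resolution of $\Lambda$ as a right $\Lambda$-module. For a right $\Lambda$-module $X$, let $\operatorname{grade} X$ be the least $i\ge 0$ with $\operatorname{Ext}^i_{\Lambda}(X,\Lambda)\neq 0$, and $\operatorname{grade} X=\infty$ if $\operatorname{Ext}^i_{\Lambda}(X,\Lambda)=0$ for all $i\ge 0$. Here $\operatorname{Ext}$ is taken over right $\Lambda$-modules. For a left $\Lambda$-module $M$, the group $\operatorname{Ext}^1_{\Lambda}(M,\Lambda)$ is regarded as a right $\Lambda$-module through the right multiplication of $\Lambda$ on the second argument. **Proposition 3.1.** The dominant dimension of $\Lambda$ is infinite, that is, $I_i$ is a flat right $\Lambda$-module for every $i\ge 0$, if and only if for every finitely generated left $\Lambda$-module $M$ the right $\Lambda$-module $\operatorname{Ext}^1_{\Lambda}(M,\Lambda)$ has infinite strong grade, that is, every nonzero right $\Lambda$-submodule of $\operatorname{Ext}^1_{\Lambda}(M,\Lambda)$ has infinite grade. -/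

import Mathlib

open CategoryTheory MulOpposite
open scoped TensorProduct

universe u

/-!
Conventions. A left module over `Λ` is a `Λ`-module in Mathlib's sense. A right `Λ`-module is a
module over the opposite ring `Λᵐᵒᵖ`, where `op a • x` stands for `x a`. In particular `Λ` with
its instance of `Module Λᵐᵒᵖ Λ` is the right regular module.
-/

namespace RightModule

/-! ### Tensor product over a noncommutative ring, and flat right modules -/

section Flat

variable (Λ : Type u) [Ring Λ]

/-- The subgroup of `I ⊗[ℤ] M` generated by the elements `x a ⊗ m - x ⊗ a m`. -/
def balancing (I M : Type u) [AddCommGroup I] [Module Λᵐᵒᵖ I] [AddCommGroup M] [Module Λ M] :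
    AddSubgroup (I ⊗[ℤ] M) :=
  AddSubgroup.closure
    {z | ∃ (x : I) (a : Λ) (m : M), z = (op a • x) ⊗ₜ[ℤ] m - x ⊗ₜ[ℤ] (a • m)}

/-- The tensor product `I ⊗_Λ M` of a right `Λ`-module `I` and a left `Λ`-module `M`. -/
abbrev Tensor (I M : Type u) [AddCommGroup I] [Module Λᵐᵒᵖ I] [AddCommGroup M] [Module Λ M] :
    Type u :=
  (I ⊗[ℤ] M) ⧸ balancing Λ I M

/-- The homomorphism `I ⊗_Λ f : I ⊗_Λ M → I ⊗_Λ N`, which sends `x ⊗ m` to `x ⊗ f m`. -/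
def Tensor.map (I : Type u) {M N : Type u} [AddCommGroup I] [Module Λᵐᵒᵖ I]
    [AddCommGroup M] [Module Λ M] [AddCommGroup N] [Module Λ N] (f : M →ₗ[Λ] N) :
    Tensor Λ I M →+ Tensor Λ I N :=
  QuotientAddGroup.map (balancing Λ I M) (balancing Λ I N)
    (LinearMap.lTensor I f.toAddMonoidHom.toIntLinearMap).toAddMonoidHom
    ((AddSubgroup.closure_le _).2 (by
      rintro _ ⟨x, a, m, rfl⟩
      refine AddSubgroup.subset_closure ⟨x, a, f m, ?_⟩
      simp))

/-- A right `Λ`-module `I` is flat if `I ⊗_Λ -` preserves injectivity of homomorphisms of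
left `Λ`-modules. -/
def IsFlat (I : Type u) [AddCommGroup I] [Module Λᵐᵒᵖ I] : Prop :=
  ∀ (M N : Type u) [AddCommGroup M] [Module Λ M] [AddCommGroup N] [Module Λ N] (f : M →ₗ[Λ] N),
    Function.Injective f → Function.Injective (Tensor.map Λ I f)

end Flat

end RightModule

/-! ### Minimal injective resolutions -/

section Resolution

/-- A submodule is essential if it meets every nonzero submodule nontrivially. -/
def Submodule.IsEssentialIn {R M : Type*} [Ring R] [AddCommGroup M] [Module R M]
    (K : Submodule R M) : Prop :=
  ∀ N : Submodule R M, N ≠ ⊥ → K ⊓ N ≠ ⊥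

/-- A minimal injective resolution `0 → M → I₀ → I₁ → ⋯` of an `R`-module `M`: an exact sequence
with every `Iᵢ` injective, in which every `Iᵢ` is an essential extension (so, an injective
envelope) of the kernel of `Iᵢ → Iᵢ₊₁`. -/
structure MinimalInjectiveResolution (R M : Type u) [Ring R] [AddCommGroup M] [Module R M] where
  /-- the `i`-th term `Iᵢ` -/
  term : ℕ → Type u
  [addCommGroup : ∀ i, AddCommGroup (term i)]
  [module : ∀ i, Module R (term i)]
  /-- the augmentation `M → I₀` -/
  ι : M →ₗ[R] term 0
  /-- the differential `Iᵢ → Iᵢ₊₁` -/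
  d : ∀ i, term i →ₗ[R] term (i + 1)
  injective : ∀ i, Module.Injective R (term i)
  ι_injective : Function.Injective ι
  exact_zero : Function.Exact ι (d 0)
  exact_succ : ∀ i, Function.Exact (d i) (d (i + 1))
  essential : ∀ i, (LinearMap.ker (d i)).IsEssentialIn

attribute [instance] MinimalInjectiveResolution.addCommGroup MinimalInjectiveResolution.module

theorem Submodule.exists_maximal_disjoint {R E : Type*} [Ring R] [AddCommGroup E] [Module R E]
    (N : Submodule R E) : ∃ C : Submodule R E, Maximal (fun C => N ⊓ C = ⊥) C := by
  refine zorn_le_nonempty₀ {C | N ⊓ C = ⊥} (fun c hc hch y hy => ⟨sSup c, ?_, fun z => le_sSup⟩)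
    ⊥ (by simp) |>.imp fun _ h => h.2
  change N ⊓ sSup c = ⊥
  rw [eq_bot_iff]
  rintro x ⟨hxN, hx⟩
  obtain ⟨C, hC, hxC⟩ := (Submodule.mem_sSup_of_directed ⟨y, hy⟩ hch.directedOn).1 hx
  exact (hc hC).le ⟨hxN, hxC⟩

/-- Every module embeds as an essential submodule in an injective module. -/
theorem exists_injectiveEnvelope (R M : Type u) [Ring R] [AddCommGroup M] [Module R M] :
    ∃ (E : ModuleCat.{u} R) (f : M →ₗ[R] E), Module.Injective R E ∧ Function.Injective f ∧
      (LinearMap.range f).IsEssentialIn := by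
  obtain ⟨E, hE, f, hf⟩ : ∃ (E : ModuleCat.{u} R), Module.Injective R E ∧
      ∃ f : M →ₗ[R] E, Function.Injective f := by
    let P := (EnoughInjectives.presentation (ModuleCat.of R M)).some
    refine ⟨P.J, (Module.injective_iff_injective_object R P.J).2 P.injective, P.f.hom, ?_⟩
    exact (ModuleCat.mono_iff_injective _).1 P.mono
  -- a maximal essential extension `N` of the image of `M` in `E`
  let S : Set (Submodule R E) := {N | LinearMap.range f ≤ N ∧
    ∀ A : Submodule R E, A ≤ N → A ≠ ⊥ → LinearMap.range f ⊓ A ≠ ⊥}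
  obtain ⟨N, -, ⟨hN, hmax⟩⟩ : ∃ N, LinearMap.range f ≤ N ∧ Maximal (fun N => N ∈ S) N := by
    refine zorn_le_nonempty₀ S (fun c hc hch y hy => ⟨sSup c, ⟨?_, ?_⟩, fun z => le_sSup⟩)
      (LinearMap.range f) ⟨le_rfl, fun A hA h0 => by rwa [inf_eq_right.2 hA]⟩
    · exact (hc hy).1.trans (le_sSup hy)
    · intro A hA h0 hbot
      obtain ⟨x, hxA, hx0⟩ := Submodule.exists_mem_ne_zero_of_ne_bot h0
      obtain ⟨C, hC, hxC⟩ := (Submodule.mem_sSup_of_directed ⟨y, hy⟩ hch.directedOn).1 (hA hxA)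
      refine (hc hC).2 (Submodule.span R {x}) (by simpa using hxC) (by simpa using hx0) ?_
      rw [eq_bot_iff, ← hbot]
      exact inf_le_inf_left _ (by simpa using hxA)
  obtain ⟨C, hC, hCmax⟩ := N.exists_maximal_disjoint
  have hq : Function.Injective (C.mkQ ∘ₗ N.subtype) := by
    rw [← LinearMap.ker_eq_bot, eq_bot_iff]
    rintro x hx
    have hxC : (x : E) ∈ C := by simpa using hx
    have : (x : E) ∈ N ⊓ C := ⟨x.2, hxC⟩
    rw [hC] at this
    simpa using this
  obtain ⟨g, hg⟩ := Module.Injective.extension_property R E _ _ _ hq N.subtype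
  have hgx (x : E) (hx : x ∈ N) : g (C.mkQ x) = x := LinearMap.congr_fun hg ⟨x, hx⟩
  -- the image of `N` is essential in `E ⧸ C`
  have hess (D : Submodule R (E ⧸ C)) (hD : D ≠ ⊥) : ∃ x ∈ N, x ≠ 0 ∧ C.mkQ x ∈ D := by
    by_contra! h
    apply hD
    have h1 : D.comap C.mkQ ≤ C := by
      refine hCmax (y := D.comap C.mkQ) ?_ (fun x hx => ?_)
      · change N ⊓ _ = ⊥
        rw [eq_bot_iff]
        rintro x ⟨hx, hxD⟩
        by_contra hx0
        exact h x hx hx0 hxD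
      · have : C.mkQ x = 0 := by simpa using hx
        simp [this]
    rw [eq_bot_iff]
    intro z hz
    obtain ⟨x, rfl⟩ := C.mkQ_surjective z
    have : x ∈ C := h1 hz
    simpa using this
  have hginj : Function.Injective g := by
    rw [← LinearMap.ker_eq_bot]
    by_contra h
    obtain ⟨x, hx, hx0, hxg⟩ := hess _ h
    exact hx0 ((hgx x hx).symm.trans hxg)
  have hrange : LinearMap.range g ≤ N := by
    refine hmax (y := LinearMap.range g) ⟨fun x hx => ⟨_, hgx x (hN.1 hx)⟩, ?_⟩
      (fun x hx => ⟨_, hgx x hx⟩)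
    intro A hA h0 hbot
    obtain ⟨y, hyA, hy0⟩ := Submodule.exists_mem_ne_zero_of_ne_bot h0
    have h1 : A.comap g ≠ ⊥ := by
      obtain ⟨z, rfl⟩ := hA hyA
      intro h
      have : z ∈ A.comap g := hyA
      rw [h] at this
      exact hy0 (by simp [(Submodule.mem_bot R).1 this])
    obtain ⟨x, hx, hx0, hxA⟩ := hess _ h1
    have hxA : x ∈ A := hgx x hx ▸ (Submodule.mem_comap.1 hxA)
    refine hN.2 (A ⊓ N) inf_le_right ?_ ?_
    · exact (Submodule.ne_bot_iff _).2 ⟨x, ⟨hxA, hx⟩, hx0⟩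
    · rw [eq_bot_iff, ← hbot]
      exact inf_le_inf_left _ inf_le_left
  let r : E →ₗ[R] N := (g ∘ₗ C.mkQ).codRestrict N fun x => hrange ⟨_, rfl⟩
  have hr (x : N) : r x = x := Subtype.ext (hgx x x.2)
  refine ⟨ModuleCat.of R N, f.codRestrict N fun x => hN.1 ⟨x, rfl⟩, ⟨?_⟩, ?_, ?_⟩
  · intro X Y _ _ _ _ i hi k
    obtain ⟨l, hl⟩ := hE.out i hi (N.subtype ∘ₗ k)
    refine ⟨r ∘ₗ l, fun x => ?_⟩
    rw [LinearMap.comp_apply, hl]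
    exact hr (k x)
  · intro x y h
    exact hf (congrArg Subtype.val h)
  · intro A h0 hbot
    refine hN.2 (A.map N.subtype) (Submodule.map_subtype_le _ _) ?_ ?_
    · obtain ⟨x, hx, hx0⟩ := Submodule.exists_mem_ne_zero_of_ne_bot h0
      exact (Submodule.ne_bot_iff _).2 ⟨x, ⟨x, hx, rfl⟩, fun h => hx0 (Subtype.ext h)⟩
    · rw [eq_bot_iff]
      rintro _ ⟨⟨m, rfl⟩, ⟨x, hxA, hxm⟩⟩
      have hmem : x ∈ (LinearMap.range (f.codRestrict N fun x => hN.1 ⟨x, rfl⟩)) ⊓ A :=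
        ⟨⟨m, Subtype.ext hxm.symm⟩, hxA⟩
      rw [hbot] at hmem
      rw [← hxm, (Submodule.mem_bot R).1 hmem]
      simp

/-- Every module has a minimal injective resolution. -/
theorem nonempty_minimalInjectiveResolution (R M : Type u) [Ring R] [AddCommGroup M]
    [Module R M] : Nonempty (MinimalInjectiveResolution R M) := by
  have step (K : ModuleCat.{u} R) : ∃ (E C : ModuleCat.{u} R) (f : K →ₗ[R] E) (q : E →ₗ[R] C),
      Module.Injective R E ∧ Function.Injective f ∧ (LinearMap.range f).IsEssentialIn ∧
        LinearMap.ker q = LinearMap.range f ∧ LinearMap.range q = ⊤ := by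
    obtain ⟨E, f, hE, hf, he⟩ := exists_injectiveEnvelope R K
    exact ⟨E, ModuleCat.of R (E ⧸ LinearMap.range f), f, Submodule.mkQ _, hE, hf, he,
      Submodule.ker_mkQ _, Submodule.range_mkQ _⟩
  choose E C f q hE hf he hq hqs using step
  -- `K i` is the `i`-th cosyzygy
  let K : ℕ → ModuleCat.{u} R := fun i => C^[i] (ModuleCat.of R M)
  have hK (i : ℕ) : K (i + 1) = C (K i) := Function.iterate_succ_apply' _ _ _
  have hd (i : ℕ) : ∃ d : E (K i) →ₗ[R] E (K (i + 1)),
      LinearMap.ker d = LinearMap.range (f (K i)) ∧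
        LinearMap.range d = LinearMap.range (f (K (i + 1))) := by
    rw [hK]
    refine ⟨f (C (K i)) ∘ₗ q (K i), ?_, ?_⟩
    · rw [LinearMap.ker_comp_of_ker_eq_bot _ (LinearMap.ker_eq_bot.2 (hf _)), hq]
    · rw [LinearMap.range_comp, hqs, LinearMap.range_eq_map]
  choose d hker hrange using hd
  exact ⟨{
    term := fun i => E (K i)
    ι := f (K 0)
    d := d
    injective := fun i => hE _
    ι_injective := hf (K 0)
    exact_zero := fun x => by
      exact LinearMap.mem_ker.symm.trans (by rw [hker 0]; rfl)
    exact_succ := fun i => LinearMap.exact_iff.2 ((hker (i + 1)).trans (hrange i).symm)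
    essential := fun i => by rw [hker]; exact he _ }⟩

end Resolution

namespace RightModule

/-! ### Ext groups, grade and strong grade -/

section Ext

variable (Λ : Type u) [Ring Λ]

/-- Right multiplication by `a`, an endomorphism of the left regular module `Λ`. -/
def rightMul (a : Λ) : ModuleCat.of Λ Λ ⟶ ModuleCat.of Λ Λ :=
  ModuleCat.ofHom (LinearMap.toSpanSingleton Λ Λ a)

/-- `Extⁱ_Λ(M, Λ)` for a left `Λ`-module `M`, computed in the category of left `Λ`-modules. -/
def LeftExt (M : Type u) [AddCommGroup M] [Module Λ M] (i : ℕ) : Type u :=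
  Abelian.Ext.{u} (ModuleCat.of Λ M) (ModuleCat.of Λ Λ) i

variable (M : Type u) [AddCommGroup M] [Module Λ M] (i : ℕ)

noncomputable instance : AddCommGroup (LeftExt Λ M i) :=
  inferInstanceAs (AddCommGroup (Abelian.Ext.{u} (ModuleCat.of Λ M) (ModuleCat.of Λ Λ) i))

/-- `Extⁱ_Λ(M, Λ)` is a right `Λ`-module: `x a` is the image of `x` under the endomorphism of
`Extⁱ_Λ(M, Λ)` that right multiplication by `a` on the second argument `Λ` induces. -/
noncomputable instance : Module Λᵐᵒᵖ (LeftExt Λ M i) where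
  smul a x := Abelian.Ext.comp (c := i) x (Abelian.Ext.mk₀ (rightMul Λ a.unop)) (add_zero i)
  one_smul x := by
    have h : rightMul Λ (unop 1) = 𝟙 _ := by ext; simp [rightMul]
    change Abelian.Ext.comp _ (Abelian.Ext.mk₀ (rightMul Λ (unop 1))) _ = _
    rw [h]
    exact Abelian.Ext.comp_mk₀_id x
  mul_smul a b x := by
    have h : rightMul Λ (unop (a * b)) = rightMul Λ b.unop ≫ rightMul Λ a.unop := by
      ext; simp [rightMul]
    change Abelian.Ext.comp _ (Abelian.Ext.mk₀ (rightMul Λ (unop (a * b)))) _ = _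
    rw [h, ← Abelian.Ext.mk₀_comp_mk₀]
    exact (Abelian.Ext.comp_assoc_of_third_deg_zero _ _ _ _).symm
  smul_zero a := Abelian.Ext.zero_comp _ _ (Abelian.Ext.mk₀ (rightMul Λ a.unop)) _ (add_zero i)
  smul_add a x y :=
    Abelian.Ext.add_comp _ _ (Abelian.Ext.mk₀ (rightMul Λ a.unop)) (add_zero i)
  add_smul a b x := by
    have h : rightMul Λ (unop (a + b)) = rightMul Λ a.unop + rightMul Λ b.unop := by
      ext; simp [rightMul]
    change Abelian.Ext.comp _ (Abelian.Ext.mk₀ (rightMul Λ (unop (a + b)))) _ = _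
    rw [h, Abelian.Ext.mk₀_add]
    exact Abelian.Ext.comp_add _ _ _ _
  zero_smul x := by
    have h : rightMul Λ (unop 0) = 0 := by ext; simp [rightMul]
    change Abelian.Ext.comp _ (Abelian.Ext.mk₀ (rightMul Λ (unop 0))) _ = _
    rw [h, Abelian.Ext.mk₀_zero]
    exact Abelian.Ext.comp_zero _ _ _ _ _

/-- The grade of a right `Λ`-module `X`: the least `i` with `Extⁱ(X, Λ) ≠ 0`, where `Ext` is
computed in the category of right `Λ`-modules, and `∞` if there is no such `i`. -/
noncomputable def grade (X : Type u) [AddCommGroup X] [Module Λᵐᵒᵖ X] : ℕ∞ :=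
  ⨅ (i : ℕ) (_ : Nontrivial (Abelian.Ext.{u} (ModuleCat.of Λᵐᵒᵖ X) (ModuleCat.of Λᵐᵒᵖ Λ) i)),
    (i : ℕ∞)

/-- The right `Λ`-module `X` has strong grade `t`: every nonzero submodule has grade `t`. -/
def HasStrongGrade (X : Type u) [AddCommGroup X] [Module Λᵐᵒᵖ X] (t : ℕ∞) : Prop :=
  ∀ A : Submodule Λᵐᵒᵖ X, A ≠ ⊥ → grade Λ A = t

end Ext

end RightModule

/-! Let `I` be an injective right module and `0 → K → P → M → 0` exact with `P` finitely generated
projective over the left noetherian ring `Λ`. Then `I ⊗ K ≅ Hom(K*, I)`, naturally in `K`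
(`pairing_injective`, `pairing_surjective`), where `K* = Hom(K, Λ)`. Since `Ext¹(M, Λ)` is the
cokernel of `P* → K*` (`exists_connecting`), `Hom(Ext¹(M, Λ), I)` is the kernel of `I ⊗ K → I ⊗ P`.
Hence `I` is flat iff there is no nonzero map `Ext¹(M, Λ) → I` for any finitely generated `M`.
Independently, for any right module `X`, all maps from `X` to the terms of the minimal resolution
vanish iff `Extⁿ(A, Λ) = 0` for all `n` and all submodules `A` of `X` (`hom_eq_zero_iff`), that is,
iff `X` has infinite strong grade. Take `X = Ext¹(M, Λ)`. -/

namespace RightModule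

/-! ### Tensor products: generators and the universal property. -/

section Tensor

variable (Λ : Type u) [Ring Λ]
variable {I M N : Type u} [AddCommGroup I] [Module Λᵐᵒᵖ I] [AddCommGroup M] [Module Λ M]
  [AddCommGroup N] [Module Λ N]

/-- The pure tensor `x ⊗ m` in `I ⊗_Λ M`, additive in both arguments. -/
def Tensor.mk : I →+ M →+ Tensor Λ I M :=
  AddMonoidHom.mk' (fun x => (QuotientAddGroup.mk' (balancing Λ I M)).comp
    (TensorProduct.mk ℤ I M x).toAddMonoidHom) fun x y => by ext m; simp

theorem Tensor.mk_smul (x : I) (a : Λ) (m : M) :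
    Tensor.mk Λ x (a • m) = Tensor.mk Λ (op a • x) m := by
  refine ((QuotientAddGroup.eq_iff_sub_mem).2 ?_).symm
  exact AddSubgroup.subset_closure ⟨x, a, m, rfl⟩

@[simp]
theorem Tensor.map_mk (f : M →ₗ[Λ] N) (x : I) (m : M) :
    Tensor.map Λ I f (Tensor.mk Λ x m) = Tensor.mk Λ x (f m) := rfl

@[elab_as_elim]
theorem Tensor.induction_on {p : Tensor Λ I M → Prop} (z : Tensor Λ I M)
    (mk : ∀ x m, p (Tensor.mk Λ x m)) (add : ∀ y z, p y → p z → p (y + z)) : p z := by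
  obtain ⟨z, rfl⟩ := QuotientAddGroup.mk_surjective z
  induction z with
  | zero => simpa using mk 0 0
  | tmul x m => exact mk x m
  | add y z hy hz => exact add _ _ hy hz

/-- A balanced biadditive map factors through the tensor product. -/
def Tensor.lift {A : Type*} [AddCommGroup A] (B : I →+ M →+ A)
    (hB : ∀ x (a : Λ) m, B (op a • x) m = B x (a • m)) : Tensor Λ I M →+ A :=
  QuotientAddGroup.lift (balancing Λ I M) (TensorProduct.liftAddHom B (by simp))
    ((AddSubgroup.closure_le _).2 (by
      rintro _ ⟨x, a, m, rfl⟩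
      simp [hB]))

@[simp]
theorem Tensor.lift_mk {A : Type*} [AddCommGroup A] (B : I →+ M →+ A)
    (hB : ∀ x (a : Λ) m, B (op a • x) m = B x (a • m)) (x : I) (m : M) :
    Tensor.lift Λ B hB (Tensor.mk Λ x m) = B x m := rfl

theorem Tensor.exists_eq_sum {ι : Type*} [Fintype ι] {k : ι → M}
    (hk : Submodule.span Λ (Set.range k) = ⊤) (z : Tensor Λ I M) :
    ∃ x : ι → I, z = ∑ j, Tensor.mk Λ (x j) (k j) := by
  induction z using Tensor.induction_on with
  | mk x m =>
    obtain ⟨a, rfl⟩ := (Submodule.mem_span_range_iff_exists_fun Λ).1 (hk ▸ Submodule.mem_top (x := m))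
    exact ⟨fun j => op (a j) • x, by simp [Tensor.mk_smul]⟩
  | add y z hy hz =>
    obtain ⟨x, rfl⟩ := hy
    obtain ⟨y, rfl⟩ := hz
    exact ⟨x + y, by simp [Finset.sum_add_distrib]⟩

/-! ### The flatness test on left ideals -/

/-- The left `Λ`-module of additive characters of a right `Λ`-module. -/
def Character (I : Type u) [AddCommGroup I] : Type u := I →+ AddCircle (1 : ℚ)

instance : AddCommGroup (Character I) := inferInstanceAs (AddCommGroup (I →+ AddCircle (1 : ℚ)))

instance : Module Λ (Character I) where
  smul a c := AddMonoidHom.comp c (DistribSMul.toAddMonoidHom I (op a))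
  one_smul c := by
    refine AddMonoidHom.ext fun x => ?_
    change c.toFun (op (1 : Λ) • x) = c.toFun x
    simp
  mul_smul a b c := by
    refine AddMonoidHom.ext fun x => ?_
    change c.toFun (op (a * b) • x) = c.toFun (op b • op a • x)
    rw [smul_smul, op_mul]
  smul_zero a := rfl
  smul_add a c d := rfl
  add_smul a b c := by
    refine AddMonoidHom.ext fun x => ?_
    change c.toFun (op (a + b) • x) = c.toFun (op a • x) + c.toFun (op b • x)
    rw [MulOpposite.op_add, add_smul]
    exact AddMonoidHom.map_add c _ _
  zero_smul c := by
    refine AddMonoidHom.ext fun x => ?_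
    change c.toFun (op (0 : Λ) • x) = 0
    rw [op_zero, zero_smul]
    exact AddMonoidHom.map_zero c

/-- The homomorphism `M → Hom(I, ℚ/ℤ)` attached to a character of `I ⊗_Λ M`. -/
def Tensor.curry (c : Tensor Λ I M →+ AddCircle (1 : ℚ)) : M →ₗ[Λ] Character I where
  toFun m := (c.comp ((Tensor.mk Λ).flip m) : I →+ AddCircle (1 : ℚ))
  map_add' m n := AddMonoidHom.ext fun x => by
    change c (Tensor.mk Λ x (m + n)) = c (Tensor.mk Λ x m) + c (Tensor.mk Λ x n)
    simp
  map_smul' a m := AddMonoidHom.ext fun x => congrArg c (Tensor.mk_smul Λ x a m)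

/-- The character of `I ⊗_Λ M` attached to a homomorphism `M → Hom(I, ℚ/ℤ)`. -/
def Tensor.uncurry (g : M →ₗ[Λ] Character I) : Tensor Λ I M →+ AddCircle (1 : ℚ) :=
  Tensor.lift Λ (AddMonoidHom.flip (id g.toAddMonoidHom : M →+ I →+ AddCircle (1 : ℚ)))
    fun x a m => (DFunLike.congr_fun
      (show (id (g (a • m)) : I →+ AddCircle (1 : ℚ)) = _ from map_smul g a m) x).symm

/-- Tensor-hom adjunction with values in `ℚ/ℤ`, which is injective (used for →) and has enough
characters to separate elements (used for ←). -/
theorem Tensor.map_injective_iff (f : M →ₗ[Λ] N) :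
    Function.Injective (Tensor.map Λ I f) ↔
      ∀ g : M →ₗ[Λ] Character I, ∃ h : N →ₗ[Λ] Character I, h ∘ₗ f = g := by
  constructor
  · intro hf g
    obtain ⟨c, hc⟩ := Module.Baer.extension_property_addMonoidHom (Q := AddCircle (1 : ℚ))
      (Module.Baer.of_divisible _) (Tensor.map Λ I f) hf (Tensor.uncurry Λ g)
    refine ⟨Tensor.curry Λ c, LinearMap.ext fun m => AddMonoidHom.ext fun x => ?_⟩
    exact DFunLike.congr_fun hc (Tensor.mk Λ x m)
  · intro h
    refine (injective_iff_map_eq_zero _).2 fun z hz => ?_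
    refine CharacterModule.eq_zero_of_character_apply fun c => ?_
    obtain ⟨g, hg⟩ := h (Tensor.curry Λ c)
    have key : ∀ z, c z = Tensor.uncurry Λ g (Tensor.map Λ I f z) := by
      intro z
      induction z using Tensor.induction_on with
      | mk x m =>
        exact (DFunLike.congr_fun (show (_ : I →+ AddCircle (1 : ℚ)) = _ from
          LinearMap.congr_fun hg m) x).symm
      | add y z hy hz => simp only [map_add, hy, hz]
    rw [key, hz, map_zero]

/-- The hypothesis is Baer's criterion for the character module of `I`. -/
theorem IsFlat.of_ideal
    (h : ∀ J : Ideal Λ, Function.Injective (Tensor.map Λ I J.subtype)) : IsFlat Λ I := by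
  have hb : Module.Baer Λ (Character I) := fun J g => by
    obtain ⟨g', hg'⟩ := (Tensor.map_injective_iff Λ _).1 (h J) g
    exact ⟨g', fun x hx => LinearMap.congr_fun hg' ⟨x, hx⟩⟩
  intro M N _ _ _ _ f hf
  exact (Tensor.map_injective_iff Λ f).2 (hb.extension_property f hf)

end Tensor

/-! ### The pairing `I ⊗_Λ K → Hom(Hom(K, Λ), I)` -/

theorem _root_.Module.Injective.exists_factor {R A B E : Type u} [Ring R] [AddCommGroup A]
    [Module R A] [AddCommGroup B] [Module R B] [AddCommGroup E] [Module R E]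
    [Module.Injective R E] (T : A →ₗ[R] B) (ψ : A →ₗ[R] E)
    (h : LinearMap.ker T ≤ LinearMap.ker ψ) : ∃ ψ' : B →ₗ[R] E, ψ' ∘ₗ T = ψ := by
  obtain ⟨ψ', h'⟩ := Module.Injective.extension_property R E _ _
    ((LinearMap.ker T).liftQ T le_rfl) (LinearMap.ker_eq_bot.1 (Submodule.ker_liftQ_eq_bot' _ _ rfl))
    ((LinearMap.ker T).liftQ ψ h)
  exact ⟨ψ', LinearMap.ext fun a => LinearMap.congr_fun h' (Submodule.Quotient.mk a)⟩

section Pairing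

variable (Λ : Type u) [Ring Λ]
variable {I K P : Type u} [AddCommGroup I] [Module Λᵐᵒᵖ I] [AddCommGroup K] [Module Λ K]
  [AddCommGroup P] [Module Λ P]

/-- The map `I ⊗_Λ K → Hom(Hom(K, Λ), I)` that sends `x ⊗ k` to `f ↦ x f(k)`. -/
def pairing : Tensor Λ I K →+ ((K →ₗ[Λ] Λ) →ₗ[Λᵐᵒᵖ] I) :=
  Tensor.lift Λ
    (AddMonoidHom.mk' (fun x => AddMonoidHom.mk' (fun k =>
      { toFun := fun f => op (f k) • x
        map_add' := fun f g => by simp [add_smul]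
        map_smul' := fun a f => by simp [smul_smul] })
      fun k l => by ext f; simp [add_smul])
      fun x y => by ext k f; simp)
    fun x a k => by ext f; simp [smul_smul]

@[simp]
theorem pairing_mk (x : I) (k : K) (f : K →ₗ[Λ] Λ) :
    pairing Λ (Tensor.mk Λ x k) f = op (f k) • x := rfl

theorem pairing_map (g : K →ₗ[Λ] P) (z : Tensor Λ I K) (f : P →ₗ[Λ] Λ) :
    pairing Λ (Tensor.map Λ I g z) f = pairing Λ z (f ∘ₗ g) := by
  induction z using Tensor.induction_on with
  | mk x k => simp
  | add y z hy hz => simp [hy, hz]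

/-- Equational criterion: with `l i` finitely many relations generating all relations among the
generators `k j`, injectivity of `I` yields `x j = ∑ y i · l i j`, so `∑ x j ⊗ k j` vanishes by the
relations. -/
theorem pairing_injective [IsNoetherianRing Λ] [Module.Finite Λ K] [Module.Injective Λᵐᵒᵖ I] :
    Function.Injective (pairing Λ : Tensor Λ I K →+ _) := by
  refine (injective_iff_map_eq_zero _).2 fun z hz => ?_
  obtain ⟨m, k, hk⟩ := Module.Finite.exists_fin (R := Λ) (M := K)
  obtain ⟨x, rfl⟩ := Tensor.exists_eq_sum Λ hk z
  let π : (Fin m → Λ) →ₗ[Λ] K := Fintype.linearCombination Λ k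
  have hπ : LinearMap.range π = ⊤ := (Fintype.range_linearCombination Λ k).trans hk
  obtain ⟨p, l, hl⟩ := Submodule.fg_iff_exists_fin_generating_family.1
    (IsNoetherian.noetherian (LinearMap.ker π))
  let ψ : (Fin m → Λ) →ₗ[Λᵐᵒᵖ] I :=
    { toFun := fun c => ∑ j, op (c j) • x j
      map_add' := fun c d => by simp [add_smul, Finset.sum_add_distrib]
      map_smul' := fun a c => by simp [Finset.smul_sum, smul_smul] }
  let T : (Fin m → Λ) →ₗ[Λᵐᵒᵖ] (Fin p → Λ) :=
    { toFun := fun c i => ∑ j, l i j * c j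
      map_add' := fun c d => by ext i; simp [mul_add, Finset.sum_add_distrib]
      map_smul' := fun a c => by ext i; simp [Finset.sum_mul, mul_assoc] }
  -- A vector `c` killed by every relation is the list of values `f (k j)` of a functional `f` on
  -- `K`; then `ψ c` is the pairing of `z` with `f`.
  have hT : LinearMap.ker T ≤ LinearMap.ker ψ := by
    intro c hc
    have hle : LinearMap.ker π ≤ LinearMap.ker (Fintype.linearCombination Λ c) := by
      rw [← hl, Submodule.span_le]
      rintro _ ⟨i, rfl⟩
      simpa [Fintype.linearCombination_apply] using! (congrFun hc i : ∑ j, l i j * c j = 0)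
    let f : K →ₗ[Λ] Λ := ((LinearMap.ker π).liftQ (Fintype.linearCombination Λ c) hle) ∘ₗ
      (π.quotKerEquivOfSurjective (LinearMap.range_eq_top.1 hπ)).symm.toLinearMap
    have hf (v) : f (π v) = Fintype.linearCombination Λ c v := by
      have : (π.quotKerEquivOfSurjective (LinearMap.range_eq_top.1 hπ)).symm (π v) =
        Submodule.Quotient.mk v := by
        rw [LinearEquiv.symm_apply_eq]; rfl
      simp [f, this]
    have hfk (j) : f (k j) = c j := by
      have := hf (Pi.single j 1)
      simpa [π] using this
    have := LinearMap.congr_fun hz f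
    simpa [ψ, hfk] using this
  obtain ⟨ψ', hψ'⟩ := Module.Injective.exists_factor T ψ hT
  let y : Fin p → I := fun i => ψ' (Pi.single i 1)
  have hψ'y (d : Fin p → Λ) : ψ' d = ∑ i, op (d i) • y i := by
    have : d = ∑ i, op (d i) • (Pi.single i 1 : Fin p → Λ) := by
      ext i; simp [Finset.sum_apply, Pi.single_apply]
    conv_lhs => rw [this]
    simp [y]
  have hx (j) : x j = ∑ i, op (l i j) • y i := by
    have h1 : ψ (Pi.single j 1) = x j := by
      simp only [ψ, LinearMap.coe_mk, AddHom.coe_mk]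
      rw [Finset.sum_eq_single j] <;> simp +contextual
    rw [← h1, ← hψ', LinearMap.comp_apply, hψ'y]
    simp [T, Pi.single_apply]
  have hl0 (i) : ∑ j, l i j • k j = 0 := by
    have : l i ∈ LinearMap.ker π := hl ▸ Submodule.subset_span ⟨i, rfl⟩
    simpa [π, Fintype.linearCombination_apply] using this
  calc ∑ j, Tensor.mk Λ (x j) (k j) = ∑ j, ∑ i, Tensor.mk Λ (y i) (l i j • k j) := by
        simp [hx, Tensor.mk_smul]
    _ = ∑ i, Tensor.mk Λ (y i) (∑ j, l i j • k j) := by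
        rw [Finset.sum_comm]; simp
    _ = 0 := by simp [hl0]

/-- Evaluation at generators embeds `K*` in `Λᵐ`; extend `φ` to `Λᵐ` and read off the coefficients
on the standard basis. -/
theorem pairing_surjective [Module.Finite Λ K] [Module.Injective Λᵐᵒᵖ I] :
    Function.Surjective (pairing Λ : Tensor Λ I K →+ _) := by
  intro φ
  obtain ⟨m, k, hk⟩ := Module.Finite.exists_fin (R := Λ) (M := K)
  let T : (K →ₗ[Λ] Λ) →ₗ[Λᵐᵒᵖ] (Fin m → Λ) :=
    { toFun := fun f j => f (k j)
      map_add' := fun f g => rfl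
      map_smul' := fun a f => rfl }
  obtain ⟨ψ, hψ⟩ := Module.Injective.exists_factor T φ (fun f hf => by
    have : f = 0 := LinearMap.ext_on_range hk fun j => congrFun hf j
    simp [this])
  refine ⟨∑ j, Tensor.mk Λ (ψ (Pi.single j 1)) (k j), LinearMap.ext fun f => ?_⟩
  have : T f = ∑ j, op (f (k j)) • (Pi.single j 1 : Fin m → Λ) := by
    ext j; simp [T, Finset.sum_apply, Pi.single_apply]
  rw [← hψ, LinearMap.comp_apply, this]
  simp

end Pairing

end RightModule

/-! ### Vanishing of `Ext` and minimal injective resolutions -/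

section Cosyzygy

open Abelian

variable {R : Type u} [Ring R]

theorem subsingleton_ext_zero_iff {X Y : Type u} [AddCommGroup X] [Module R X] [AddCommGroup Y]
    [Module R Y] : Subsingleton (Ext.{u} (ModuleCat.of R X) (ModuleCat.of R Y) 0) ↔
      ∀ f : X →ₗ[R] Y, f = 0 := by
  rw [Ext.homEquiv₀.subsingleton_congr, ModuleCat.homEquiv.subsingleton_congr]
  exact ⟨fun _ f => Subsingleton.elim _ _, fun h => ⟨fun f g => (h f).trans (h g).symm⟩⟩

theorem subsingleton_ext_congr {X Y Z : Type u} [AddCommGroup X] [Module R X] [AddCommGroup Y]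
    [Module R Y] [AddCommGroup Z] [Module R Z] (e : Y ≃ₗ[R] Z) (n : ℕ) :
    Subsingleton (Ext.{u} (ModuleCat.of R X) (ModuleCat.of R Y) n) ↔
      Subsingleton (Ext.{u} (ModuleCat.of R X) (ModuleCat.of R Z) n) :=
  (((extFunctorObj (ModuleCat.of R X) n).mapIso
    e.toModuleIso).addCommGroupIsoToAddEquiv).toEquiv.subsingleton_congr

variable {M : Type u} [AddCommGroup M] [Module R M] (I : MinimalInjectiveResolution R M)

namespace MinimalInjectiveResolution

/-- The short complex `0 → Kᵢ → Iᵢ → Kᵢ₊₁ → 0`, where `Kᵢ` is the kernel of `Iᵢ → Iᵢ₊₁`. -/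
def cosyzygyComplex (i : ℕ) : ShortComplex (ModuleCat.{u} R) :=
  ModuleCat.shortComplexOfCompEqZero (LinearMap.ker (I.d i)).subtype
    ((I.d i).codRestrict (LinearMap.ker (I.d (i + 1)))
      fun x => (I.exact_succ i _).2 ⟨x, rfl⟩)
    (by ext x; exact x.2)

theorem cosyzygyComplex_shortExact (i : ℕ) : (I.cosyzygyComplex i).ShortExact := by
  refine ModuleCat.shortComplex_shortExact _ ?_ (Submodule.injective_subtype _) ?_
  · intro x
    constructor
    · intro h
      exact ⟨⟨x, congrArg Subtype.val h⟩, rfl⟩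
    · rintro ⟨y, rfl⟩
      exact Subtype.ext y.2
  · rintro ⟨y, hy⟩
    obtain ⟨x, rfl⟩ := (I.exact_succ i y).1 hy
    exact ⟨x, rfl⟩

/-- The augmentation identifies the module with the zeroth cosyzygy. -/
noncomputable def equivKer : M ≃ₗ[R] LinearMap.ker (I.d 0) :=
  (LinearEquiv.ofInjective I.ι I.ι_injective).trans
    (LinearEquiv.ofEq _ _ (LinearMap.exact_iff.1 I.exact_zero).symm)

theorem subsingleton_ext_term (X : ModuleCat.{u} R) (i n : ℕ) :
    Subsingleton (Ext.{u} X (ModuleCat.of R (I.term i)) (n + 1)) :=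
  have := (Module.injective_iff_injective_object R (I.term i)).1 (I.injective i)
  Ext.subsingleton_of_injective _ _ _

variable {X : Type u} [AddCommGroup X] [Module R X]

/-- Dimension shifting: `Extⁿ⁺¹(X, Kᵢ)` is a quotient of `Extⁿ(X, Kᵢ₊₁)`, because `Extⁿ⁺¹(X, Iᵢ) =
0`. -/
theorem subsingleton_ext_ker_of_hom_eq_zero (h : ∀ i (f : X →ₗ[R] I.term i), f = 0) (n i : ℕ) :
    Subsingleton (Ext.{u} (ModuleCat.of R X) (ModuleCat.of R (LinearMap.ker (I.d i))) n) := by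
  induction n generalizing i with
  | zero =>
    refine subsingleton_ext_zero_iff.2 fun f => LinearMap.ext fun x => Subtype.ext ?_
    exact LinearMap.congr_fun (h i ((LinearMap.ker (I.d i)).subtype ∘ₗ f)) x
  | succ n ih =>
    refine subsingleton_of_forall_eq 0 fun e => ?_
    have := I.subsingleton_ext_term (ModuleCat.of R X) i n
    obtain ⟨y, rfl⟩ := Ext.covariant_sequence_exact₁ (ModuleCat.of R X)
      (I.cosyzygyComplex_shortExact i) e
      (this.elim _ _) rfl
    rw [(ih (i + 1)).elim y 0]
    exact Ext.zero_comp _ _ _ _ _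

/-- Minimality enters here: a nonzero image of `f` would meet the essential submodule `Kᵢ`, so `f`
would be nonzero on the preimage of `Kᵢ`. This is why all submodules of `X` must be considered. -/
theorem hom_eq_zero_of_hom_ker_eq_zero (i : ℕ)
    (h : ∀ (A : Submodule R X) (f : A →ₗ[R] LinearMap.ker (I.d i)), f = 0)
    (f : X →ₗ[R] I.term i) : f = 0 := by
  by_contra hf
  refine I.essential i (LinearMap.range f) (mt LinearMap.range_eq_bot.1 hf) ?_
  rw [eq_bot_iff]
  rintro _ ⟨hx, ⟨x, rfl⟩⟩
  have := h ((LinearMap.ker (I.d i)).comap f)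
    ((f ∘ₗ Submodule.subtype _).codRestrict _ fun y => y.2)
  exact congrArg Subtype.val (LinearMap.congr_fun this ⟨x, hx⟩)

/-- Induction on `i`, for all `A` and `n` at once: `Extⁿ(A, Kᵢ₊₁)` lies between `Extⁿ(A, Iᵢ)` and
`Extⁿ⁺¹(A, Kᵢ)`. For `n = 0` a map `A → Iᵢ` extends to `X`, where essentiality kills it. -/
theorem subsingleton_ext_ker (h : ∀ (A : Submodule R X) (n : ℕ),
    Subsingleton (Ext.{u} (ModuleCat.of R A) (ModuleCat.of R M) n)) (i : ℕ)
    (A : Submodule R X) (n : ℕ) :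
    Subsingleton (Ext.{u} (ModuleCat.of R A) (ModuleCat.of R (LinearMap.ker (I.d i))) n) := by
  induction i generalizing A n with
  | zero => exact (subsingleton_ext_congr I.equivKer n).1 (h A n)
  | succ i ih =>
    have hI : Subsingleton (Ext.{u} (ModuleCat.of R A) (ModuleCat.of R (I.term i)) n) := by
      cases n with
      | zero =>
        refine subsingleton_ext_zero_iff.2 fun f => ?_
        have := I.injective i
        obtain ⟨g, rfl⟩ := Module.Injective.extension_property R (I.term i) _ _ A.subtype
          A.injective_subtype f
        rw [I.hom_eq_zero_of_hom_ker_eq_zero i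
          (fun B => subsingleton_ext_zero_iff.1 (ih B 0)) g, LinearMap.zero_comp]
      | succ n => exact I.subsingleton_ext_term _ _ _
    refine subsingleton_of_forall_eq 0 fun e => ?_
    obtain ⟨y, rfl⟩ := Ext.covariant_sequence_exact₃ (ModuleCat.of R A)
      (I.cosyzygyComplex_shortExact i) e rfl ((ih A (n + 1)).elim _ _)
    rw [hI.elim y 0]
    exact Ext.zero_comp _ _ _ _ _

theorem hom_eq_zero_iff : (∀ i (f : X →ₗ[R] I.term i), f = 0) ↔
    ∀ (A : Submodule R X) (n : ℕ),
      Subsingleton (Ext.{u} (ModuleCat.of R A) (ModuleCat.of R M) n) := by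
  constructor
  · intro h A n
    refine (subsingleton_ext_congr I.equivKer n).2
      (I.subsingleton_ext_ker_of_hom_eq_zero (fun i f => ?_) n 0)
    have := I.injective i
    obtain ⟨g, rfl⟩ := Module.Injective.extension_property R (I.term i) _ _ A.subtype
      A.injective_subtype f
    rw [h i g, LinearMap.zero_comp]
  · intro h i
    exact I.hom_eq_zero_of_hom_ker_eq_zero i
      fun A => subsingleton_ext_zero_iff.1 (I.subsingleton_ext_ker h i A 0)

end MinimalInjectiveResolution

end Cosyzygy

/-! ### Infinite strong grade as vanishing of maps into the resolution. -/

namespace RightModule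

variable (Λ : Type u) [Ring Λ]

theorem grade_eq_top_iff {X : Type u} [AddCommGroup X] [Module Λᵐᵒᵖ X] :
    grade Λ X = ⊤ ↔ ∀ n, Subsingleton
      (Abelian.Ext.{u} (ModuleCat.of Λᵐᵒᵖ X) (ModuleCat.of Λᵐᵒᵖ Λ) n) := by
  simp [grade, not_nontrivial_iff_subsingleton]

theorem hasStrongGrade_top_iff (I : MinimalInjectiveResolution Λᵐᵒᵖ Λ) {X : Type u}
    [AddCommGroup X] [Module Λᵐᵒᵖ X] :
    HasStrongGrade Λ X ⊤ ↔ ∀ i (f : X →ₗ[Λᵐᵒᵖ] I.term i), f = 0 := by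
  rw [I.hom_eq_zero_iff]
  refine ⟨fun h A n => ?_, fun h A _ => (grade_eq_top_iff Λ).2 (h A)⟩
  -- Strong grade says nothing about the zero submodule, whose `Ext` groups vanish anyway.
  by_cases hA : A = ⊥
  · subst hA
    refine subsingleton_of_forall_eq 0 fun e => ?_
    have h0 : 𝟙 (ModuleCat.of Λᵐᵒᵖ (⊥ : Submodule Λᵐᵒᵖ X)) = 0 := by
      ext x
    rw [← Abelian.Ext.mk₀_id_comp e, h0, Abelian.Ext.mk₀_zero, Abelian.Ext.zero_comp]
  · exact (grade_eq_top_iff Λ).1 (h A hA) n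

/-! ### `Ext¹` as a cokernel -/

section Connecting

variable {Λ}
variable {K P M : Type u} [AddCommGroup K] [Module Λ K] [AddCommGroup P] [Module Λ P]
  [AddCommGroup M] [Module Λ M]

/-- The long exact sequence with `Ext¹(P, Λ) = 0`. The connecting map is right linear because `Λ`
acts on both sides by composition with right multiplications. -/
theorem exists_connecting [Module.Projective Λ P] (f : K →ₗ[Λ] P) (g : P →ₗ[Λ] M)
    (hf : Function.Injective f) (hg : Function.Surjective g) (hfg : Function.Exact f g) :
    ∃ δ : (K →ₗ[Λ] Λ) →ₗ[Λᵐᵒᵖ] LeftExt Λ M 1, Function.Surjective δ ∧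
      ∀ φ, δ φ = 0 ↔ ∃ ψ : P →ₗ[Λ] Λ, ψ ∘ₗ f = φ := by
  let S := ModuleCat.shortComplexOfCompEqZero f g hfg.linearMap_comp_eq_zero
  have hS : S.ShortExact := ModuleCat.shortComplex_shortExact S hfg hf hg
  let δ : (K →ₗ[Λ] Λ) →ₗ[Λᵐᵒᵖ] LeftExt Λ M 1 :=
    { toFun := fun φ => hS.extClass.comp (Abelian.Ext.mk₀ (ModuleCat.ofHom φ)) (add_zero 1)
      map_add' := fun φ ψ => by
        rw [ModuleCat.ofHom_add, Abelian.Ext.mk₀_add]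
        exact Abelian.Ext.comp_add _ _ _ _
      map_smul' := fun a φ => by
        have h : ModuleCat.ofHom (a • φ) = ModuleCat.ofHom φ ≫ rightMul Λ a.unop := by
          ext k; rfl
        rw [h, ← Abelian.Ext.mk₀_comp_mk₀]
        exact (Abelian.Ext.comp_assoc_of_third_deg_zero _ _ _ _).symm }
  refine ⟨δ, fun e => ?_, fun φ => ⟨fun h => ?_, ?_⟩⟩
  · have : Projective (ModuleCat.of Λ P) := (IsProjective.iff_projective P).1 inferInstance
    obtain ⟨x, hx⟩ := Abelian.Ext.contravariant_sequence_exact₃ hS (ModuleCat.of Λ Λ) e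
      (Abelian.Ext.eq_zero_of_projective (P := ModuleCat.of Λ P) _) (add_zero 1)
    obtain ⟨φ, rfl⟩ := Abelian.Ext.homEquiv₀.symm.surjective x
    exact ⟨φ.hom, hx⟩
  · obtain ⟨x, hx⟩ := Abelian.Ext.contravariant_sequence_exact₁ hS (ModuleCat.of Λ Λ) _ (add_zero 1) h
    obtain ⟨ψ, rfl⟩ := Abelian.Ext.homEquiv₀.symm.surjective x
    refine ⟨ψ.hom, ?_⟩
    have h1 : Abelian.Ext.mk₀ (S.f ≫ ψ) = Abelian.Ext.mk₀ (ModuleCat.ofHom φ) :=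
      (Abelian.Ext.mk₀_comp_mk₀ _ _).symm.trans hx
    have h2 := Abelian.Ext.homEquiv₀.symm.injective h1
    exact congrArg ModuleCat.Hom.hom h2
  · rintro ⟨ψ, rfl⟩
    change hS.extClass.comp (Abelian.Ext.mk₀ (S.f ≫ ModuleCat.ofHom ψ)) (add_zero 1) = 0
    rw [← Abelian.Ext.mk₀_comp_mk₀]
    exact hS.extClass_comp_assoc _

end Connecting

end RightModule

/-! ### Flatness of an injective module through maps out of `Ext¹`. -/

namespace RightModule

variable (Λ : Type u) [Ring Λ] [IsNoetherianRing Λ]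
variable {I : Type u} [AddCommGroup I] [Module Λᵐᵒᵖ I] [Module.Injective Λᵐᵒᵖ I]

theorem IsFlat.hom_leftExt_eq_zero (hI : IsFlat Λ I) (M : Type u) [AddCommGroup M] [Module Λ M]
    [Module.Finite Λ M] (φ : LeftExt Λ M 1 →ₗ[Λᵐᵒᵖ] I) : φ = 0 := by
  obtain ⟨n, g, hg⟩ := Module.Finite.exists_fin' Λ M
  obtain ⟨δ, hδ, hδ0⟩ := exists_connecting (LinearMap.ker g).subtype g
    (Submodule.injective_subtype _) hg g.exact_subtype_ker_map
  -- `z` dies in `I ⊗ P`, since `δ` kills the functionals that extend to `P`; flatness then gives `z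
  -- = 0`.
  obtain ⟨z, hz⟩ := pairing_surjective Λ (φ ∘ₗ δ)
  have hz0 : z = 0 := by
    refine (injective_iff_map_eq_zero _).1 (hI _ _ _ (Submodule.injective_subtype _)) z ?_
    refine (injective_iff_map_eq_zero _).1 (pairing_injective Λ) _ (LinearMap.ext fun h => ?_)
    rw [pairing_map, hz, LinearMap.comp_apply, (hδ0 _).2 ⟨h, rfl⟩, map_zero,
      LinearMap.zero_apply]
  refine LinearMap.ext fun e => ?_
  obtain ⟨f, rfl⟩ := hδ e
  rw [← LinearMap.comp_apply, ← hz, hz0, map_zero, LinearMap.zero_apply, LinearMap.zero_apply]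

theorem IsFlat.of_hom_leftExt_eq_zero
    (h : ∀ (J : Ideal Λ) (φ : LeftExt Λ (Λ ⧸ J) 1 →ₗ[Λᵐᵒᵖ] I), φ = 0) : IsFlat Λ I := by
  refine IsFlat.of_ideal Λ fun J => (injective_iff_map_eq_zero _).2 fun z hz => ?_
  obtain ⟨δ, hδ, hδ0⟩ := exists_connecting J.subtype J.mkQ (Submodule.injective_subtype _)
    J.mkQ_surjective (LinearMap.exact_subtype_mkQ J)
  -- Since `z` dies in `I ⊗ Λ`, its pairing kills functionals extending to `Λ`, so it factors
  -- through `Ext¹(Λ ⧸ J, Λ)`.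
  have hker : LinearMap.ker δ ≤ LinearMap.ker (pairing Λ z) := by
    intro f hf
    obtain ⟨ψ, rfl⟩ := (hδ0 f).1 hf
    rw [LinearMap.mem_ker, ← pairing_map, hz, map_zero, LinearMap.zero_apply]
  obtain ⟨φ, hφ⟩ := Module.Injective.exists_factor δ (pairing Λ z) hker
  refine (injective_iff_map_eq_zero _).1 (pairing_injective Λ) z ?_
  rw [← hφ, h J φ, LinearMap.zero_comp]

end RightModule

/-- `Λ` is a left and right noetherian ring, and `I` is a minimal injective resolution of the right
module `Λ`. The left-hand side says that the dominant dimension of `Λ` is infinite. -/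
theorem proposition3p1 (Λ : Type u) [Ring Λ] [IsNoetherianRing Λ] [IsNoetherianRing Λᵐᵒᵖ]
    (I : MinimalInjectiveResolution Λᵐᵒᵖ Λ) :
    (∀ i, RightModule.IsFlat Λ (I.term i)) ↔
      ∀ (M : Type u) [AddCommGroup M] [Module Λ M] [Module.Finite Λ M],
        RightModule.HasStrongGrade Λ (RightModule.LeftExt Λ M 1) ⊤ := by
  simp only [RightModule.hasStrongGrade_top_iff Λ I]
  constructor
  · intro h M _ _ _ i
    have := I.injective i
    exact (h i).hom_leftExt_eq_zero Λ M
  · intro h i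
    have := I.injective i
    exact RightModule.IsFlat.of_hom_leftExt_eq_zero Λ fun J => h (Λ ⧸ J) i
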